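/- Let $n\ge 0$ and let $G\le S_n$ act on $\mathbb R^n$ by permuting coordinates, $(s\cdot x)_i=x_{s^{-1}(i)}$. Let $B=(b_1,\dots,b_k)$ be a base for $G$, i.e. a finite tuple of elements of $\{1,\dots,n\}$ such that the only element of $G$ fixing every $b_i$ is the identity. Put $G_0=G$ and, for $1\le i\le k$, $G_i=\{g\in G_{i-1}: g(b_i)=b_i\}$, and let $\Delta_i=\{g(b_i): g\in G_{i-1}\}$. Let $\varepsilon\in\mathbb R^n$ be a perturbation vector: its entries are pairwise distinct and $|\varepsilon_i-\varepsilon_j|<1$ for all $i,j$. For $x\in\mathbb R^n$ define $\hat x\in\mathbb R^n$ by $\hat x_i=|\{j: x_j\le x_i\}|+\varepsilon_i$; its entries are pairwise distinct. Given $x\in\mathbb R^n$, choose successively for $i=1,\dots,k$ an element $g_i\in G_{i-1}$ with $g_i(j)=b_i$, where $j\in\Delta_i$ is an index such that the $j$-th entry of $(g_{i-1}\cdots g_1)\cdot\hat x$ is minimal among the entries of this vector indexed by $\Delta_i$. Put $\phi_\uparrow(\hat x)=g_k\cdots g_1\in G$ and $\pi_\uparrow(x)=\phi_\uparrow(\hat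 x)\cdot x$. A fundamental domain for $G$ is an open connected non-empty set $F\subset\mathbb R^n$ such that every $G$-orbit meets the closure $\overline F$ and every $G$-orbit meets $F$ in at most one point. A map $\pi:\mathbb R^n\to\mathbb R^n$ is a projection onto the fundamental domain $F$ if $\pi(x)\in (G\cdot x)\cap\overline F$ for every $x\in\mathbb R^n$, and $\pi(g\cdot x)=x$ for all $x\in F$ and $g\in G$. Theorem. For every $x$ such choices of $g_1,\dots,g_k$ exist, and the product $g_k\cdots g_1$ does not depend on them; hence the map $\pi_\uparrow:\mathbb R^n\to\mathbb R^n$ is well defined and uniquely determined by $B$ and $\varepsilon$ (for the given $G$). Moreover, the interior $F$ of the image of $\pi_\uparrow$ is a fundamental domain for $G$, and $\pi_\uparrow$ is a projection onto $F$. -/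

import Mathlib

namespace CombProj

/-- The left action of `S_n` on `ℝⁿ` by permuting coordinates: `(s · x)_i = x_{s⁻¹(i)}`. -/
def permute {n : ℕ} (s : Equiv.Perm (Fin n)) (x : Fin n → ℝ) : Fin n → ℝ :=
  fun i => x (s⁻¹ i)

/-- A tuple `B = (b₁, …, b_k)` of indices is a base for `G ≤ S_n` if only the identity of `G`
fixes every `b_i`. -/
def IsBase {n : ℕ} (G : Subgroup (Equiv.Perm (Fin n))) (B : List (Fin n)) : Prop :=
  ∀ g ∈ G, (∀ b ∈ B, g b = b) → g = 1

/-- Admissible perturbation vectors: the entries are pairwise distinct, and any two of them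
differ by less than `1`. -/
structure IsPerturbation {n : ℕ} (ε : Fin n → ℝ) : Prop where
  injective : Function.Injective ε
  abs_sub_lt_one : ∀ i j, |ε i - ε j| < 1

/-- The perturbed point `x̂`: replace `x_i` by the integer `|{j | x_j ≤ x_i}|` and then
add `ε_i`. -/
noncomputable def perturb {n : ℕ} (ε x : Fin n → ℝ) : Fin n → ℝ :=
  fun i => ((Finset.univ.filter (fun j => x j ≤ x i)).card : ℝ) + ε i

/-- `IsAscendingElement B G y g` says that `g = g_k ⋯ g_1` for some admissible choice of
`g_1, …, g_k`. With `B = (b_1, …, b_k)`, `G_0 = G`, `G_i = G_{i-1} ∩ Stab(b_i)` and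
`Δ_i` the `G_{i-1}`-orbit of `b_i`, a choice is admissible if for each `i` there is `j ∈ Δ_i`
such that the `j`-th entry of `(g_{i-1} ⋯ g_1) · y` is minimal among the entries indexed
by `Δ_i`, and `g_i ∈ G_{i-1}` moves the index `j` to `b_i`. The recursion is along `B`; the
arguments `G` and `y` are the current group `G_{i-1}` and point `(g_{i-1} ⋯ g_1) · y`. -/
def IsAscendingElement {n : ℕ} : List (Fin n) → Subgroup (Equiv.Perm (Fin n)) →
    (Fin n → ℝ) → Equiv.Perm (Fin n) → Prop
  | [], _, _, g => g = 1
  | b :: B, G, y, g =>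
      ∃ j ∈ MulAction.orbit G b, (∀ j' ∈ MulAction.orbit G b, y j ≤ y j') ∧
        ∃ g₁ ∈ G, g₁ j = b ∧
          ∃ h, IsAscendingElement B (G ⊓ MulAction.stabilizer (Equiv.Perm (Fin n)) b)
            (permute g₁ y) h ∧ g = h * g₁

/-- `π` is a map obtained by the ascending construction: for every `x` one runs the
construction on `x̂`, with some choice of `g_1, …, g_k`, and puts
`π(x) = (g_k ⋯ g_1) · x`. -/
def IsAscendingMap {n : ℕ} (G : Subgroup (Equiv.Perm (Fin n))) (B : List (Fin n))
    (ε : Fin n → ℝ) (π : (Fin n → ℝ) → (Fin n → ℝ)) : Prop :=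
  ∀ x, ∃ g, IsAscendingElement B G (perturb ε x) g ∧ π x = permute g x

/-- Fundamental domains for `G ≤ S_n` acting on `ℝⁿ`. -/
structure IsFundDomain {n : ℕ} (G : Subgroup (Equiv.Perm (Fin n))) (F : Set (Fin n → ℝ)) :
    Prop where
  isOpen : IsOpen F
  isConnected : IsConnected F
  /-- Every orbit meets the closure of `F`. -/
  orbit_meets_closure : ∀ x, ∃ g ∈ G, permute g x ∈ closure F
  /-- Every orbit meets `F` in at most one point. -/
  orbit_meets_once : ∀ g ∈ G, ∀ x ∈ F, permute g x ∈ F → permute g x = x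

/-- `π` projects `ℝⁿ` onto the fundamental domain `F`: it sends each point to a point of its own
orbit in the closure of `F`, and each orbit that meets `F` is sent to its point in `F`. -/
structure IsProjectionOnto {n : ℕ} (G : Subgroup (Equiv.Perm (Fin n))) (F : Set (Fin n → ℝ))
    (π : (Fin n → ℝ) → (Fin n → ℝ)) : Prop where
  mem_orbit : ∀ x, ∃ g ∈ G, π x = permute g x
  mem_closure : ∀ x, π x ∈ closure F
  orbit_to_point : ∀ x ∈ F, ∀ g ∈ G, π (permute g x) = x

end CombProj

namespace CombProj

variable {n : ℕ}

/-! The domain is the cone of points whose entry at each `b_i` is strictly smallest on `Δ_i`. It is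
open and convex, and its closure is the cone of the weak inequalities. The proof rests on a rigidity
statement, `eq_one_of_permute_mem_closedCone`: only the identity of `G` carries a point of the open
cone into the closed one. The algorithm moves `x̂`, whose entries are distinct, into the open cone,
so rigidity makes its output unique. Since `x̂` refines the order of the entries of `x`, the same
element moves `x` into the closed cone. By rigidity again, each orbit meeting the open cone is sent
to its point there. The image thus lies between the two cones and has the open cone as interior. -/

@[simp]
theorem permute_one (x : Fin n → ℝ) : permute 1 x = x := by
  funext i
  simp [permute]

theorem permute_mul (g h : Equiv.Perm (Fin n)) (x : Fin n → ℝ) :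
    permute (g * h) x = permute g (permute h x) := by
  funext i
  simp [permute]

theorem permute_injective {g : Equiv.Perm (Fin n)} {x : Fin n → ℝ}
    (hx : Function.Injective x) : Function.Injective (permute g x) :=
  hx.comp (g⁻¹).injective

theorem apply_mem_orbit {G : Subgroup (Equiv.Perm (Fin n))} {g : Equiv.Perm (Fin n)}
    (hg : g ∈ G) {b j : Fin n} (hj : j ∈ MulAction.orbit G b) :
    g j ∈ MulAction.orbit G b := by
  obtain ⟨s, rfl⟩ := hj
  exact ⟨⟨g, hg⟩ * s, rfl⟩

/-- The open cone of the points `x` such that, for each `i`, the entry `x_{b_i}` is the strict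
minimum of the entries indexed by `Δ_i`. -/
def openCone : List (Fin n) → Subgroup (Equiv.Perm (Fin n)) → Set (Fin n → ℝ)
  | [], _ => Set.univ
  | b :: B, G => {x | ∀ j ∈ MulAction.orbit G b, j ≠ b → x b < x j} ∩
      openCone B (G ⊓ MulAction.stabilizer (Equiv.Perm (Fin n)) b)

/-- The closed cone of the points `x` such that, for each `i`, the entry `x_{b_i}` is minimal
among the entries indexed by `Δ_i`. -/
def closedCone : List (Fin n) → Subgroup (Equiv.Perm (Fin n)) → Set (Fin n → ℝ)
  | [], _ => Set.univ
  | b :: B, G => {x | ∀ j ∈ MulAction.orbit G b, x b ≤ x j} ∩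
      closedCone B (G ⊓ MulAction.stabilizer (Equiv.Perm (Fin n)) b)

theorem isOpen_openCone (B : List (Fin n)) (G : Subgroup (Equiv.Perm (Fin n))) :
    IsOpen (openCone B G) := by
  induction B generalizing G with
  | nil => exact isOpen_univ
  | cons b B ih =>
    refine IsOpen.inter ?_ (ih _)
    simp only [Set.ofPred_forall]
    refine isOpen_iInter_of_finite fun j => isOpen_iInter_of_finite fun _ =>
      isOpen_iInter_of_finite fun _ => ?_
    exact isOpen_lt (continuous_apply b) (continuous_apply j)

theorem isClosed_closedCone (B : List (Fin n)) (G : Subgroup (Equiv.Perm (Fin n))) :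
    IsClosed (closedCone B G) := by
  induction B generalizing G with
  | nil => exact isClosed_univ
  | cons b B ih =>
    refine IsClosed.inter ?_ (ih _)
    simp only [Set.ofPred_forall]
    exact isClosed_iInter fun j => isClosed_iInter fun _ =>
      isClosed_le (continuous_apply b) (continuous_apply j)

theorem convex_openCone (B : List (Fin n)) (G : Subgroup (Equiv.Perm (Fin n))) :
    Convex ℝ (openCone B G) := by
  induction B generalizing G with
  | nil => exact convex_univ
  | cons b B ih =>
    refine Convex.inter ?_ (ih _)
    intro x hx y hy s t hs ht hst j hj hjb
    have h₁ := hx j hj hjb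
    have h₂ := hy j hj hjb
    simp only [Pi.add_apply, Pi.smul_apply, smul_eq_mul]
    rcases hs.eq_or_lt with rfl | hs
    · obtain rfl : t = 1 := by linarith
      simpa using h₂
    · have := mul_lt_mul_of_pos_left h₁ hs
      have := mul_le_mul_of_nonneg_left h₂.le ht
      linarith

/-- Passing from `z` to a point whose entries are weakly ordered the same way maps the open cone
into the closed one. -/
theorem mem_closedCone_of_mem_openCone {B : List (Fin n)} {G : Subgroup (Equiv.Perm (Fin n))}
    {z x : Fin n → ℝ} (hzx : ∀ i j, z i < z j → x i ≤ x j) (hz : z ∈ openCone B G) :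
    x ∈ closedCone B G := by
  induction B generalizing G with
  | nil => trivial
  | cons b B ih =>
    refine ⟨fun j hj => ?_, ih hz.2⟩
    by_cases hjb : j = b
    · rw [hjb]
    · exact hzx _ _ (hz.1 j hj hjb)

theorem openCone_subset_closedCone (B : List (Fin n)) (G : Subgroup (Equiv.Perm (Fin n))) :
    openCone B G ⊆ closedCone B G :=
  fun _ hx => mem_closedCone_of_mem_openCone (fun _ _ h => h.le) hx

theorem add_smul_mem_openCone {B : List (Fin n)} {G : Subgroup (Equiv.Perm (Fin n))}
    {x z : Fin n → ℝ} (hx : x ∈ closedCone B G) (hz : z ∈ openCone B G) {t : ℝ} (ht : 0 < t) :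
    x + t • z ∈ openCone B G := by
  induction B generalizing G with
  | nil => trivial
  | cons b B ih =>
    refine ⟨fun j hj hjb => ?_, ih hx.2 hz.2⟩
    exact add_lt_add_of_le_of_lt (hx.1 j hj) (mul_lt_mul_of_pos_left (hz.1 j hj hjb) ht)

/-- Adding a small positive multiple of an open-cone point makes all weak inequalities strict. -/
theorem closure_openCone {B : List (Fin n)} {G : Subgroup (Equiv.Perm (Fin n))}
    (hne : (openCone B G).Nonempty) : closure (openCone B G) = closedCone B G := by
  refine (closure_minimal (openCone_subset_closedCone B G) (isClosed_closedCone B G)).antisymm ?_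
  intro x hx
  obtain ⟨z, hz⟩ := hne
  have hcont : Filter.Tendsto (fun t : ℝ => x + t • z) (nhdsWithin 0 (Set.Ioi 0)) (nhds x) := by
    have : Continuous fun t : ℝ => x + t • z := by fun_prop
    simpa using (this.tendsto 0).mono_left nhdsWithin_le_nhds
  exact mem_closure_of_tendsto hcont
    (Filter.eventually_of_mem self_mem_nhdsWithin fun t ht => add_smul_mem_openCone hx hz ht)

theorem interior_closedCone {B : List (Fin n)} {G : Subgroup (Equiv.Perm (Fin n))}
    (hne : (openCone B G).Nonempty) : interior (closedCone B G) = openCone B G := by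
  have hint := (isOpen_openCone B G).interior_eq
  rw [← closure_openCone hne, (convex_openCone B G).interior_closure_eq_interior_of_nonempty_interior
    (by rwa [hint]), hint]

/-- An element of `G` moving a point of the open cone into the closed cone is trivial. -/
theorem eq_one_of_permute_mem_closedCone {B : List (Fin n)}
    {G : Subgroup (Equiv.Perm (Fin n))} (hB : IsBase G B) {x : Fin n → ℝ}
    (hx : x ∈ openCone B G) {g : Equiv.Perm (Fin n)} (hg : g ∈ G)
    (hgx : permute g x ∈ closedCone B G) : g = 1 := by
  induction B generalizing G with
  | nil => exact hB g hg (by simp)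
  | cons b B ih =>
    -- The weak inequality for `g · x` at the index `g b` reads `x (g⁻¹ b) ≤ x b`, which contradicts
    -- strict minimality at `b` unless `g⁻¹ b = b`.
    have hgb : g b = b := by
      have hle := hgx.1 (g b) (apply_mem_orbit hg (MulAction.mem_orbit_self b))
      have hmem := apply_mem_orbit (G.inv_mem hg) (MulAction.mem_orbit_self (M := G) b)
      simp only [permute, Equiv.Perm.inv_def, Equiv.symm_apply_apply] at hle
      by_contra hne
      exact (hx.1 _ hmem fun h => hne (Equiv.Perm.inv_eq_iff_eq.1 h).symm).not_ge hle
    refine ih (fun s hs hsB => ?_) hx.2 ⟨hg, hgb⟩ hgx.2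
    refine hB s hs.1 ?_
    rintro c (_ | ⟨_, hc⟩)
    · exact hs.2
    · exact hsB c hc

theorem exists_isAscendingElement (B : List (Fin n)) (G : Subgroup (Equiv.Perm (Fin n)))
    (y : Fin n → ℝ) : ∃ g, IsAscendingElement B G y g := by
  induction B generalizing G y with
  | nil => exact ⟨1, rfl⟩
  | cons b B ih =>
    obtain ⟨j, hj, hmin⟩ := Set.exists_min_image (MulAction.orbit G b) y (Set.toFinite _)
      ⟨b, MulAction.mem_orbit_self b⟩
    obtain ⟨s, hs⟩ := id hj
    obtain ⟨h, hh⟩ := ih (G ⊓ MulAction.stabilizer (Equiv.Perm (Fin n)) b)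
      (permute (s : Equiv.Perm (Fin n))⁻¹ y)
    exact ⟨_, j, hj, hmin, _, G.inv_mem s.2, Equiv.Perm.inv_eq_iff_eq.2 hs.symm, h, hh, rfl⟩

theorem IsAscendingElement.mem {B : List (Fin n)} {G : Subgroup (Equiv.Perm (Fin n))}
    {y : Fin n → ℝ} {g : Equiv.Perm (Fin n)} (hg : IsAscendingElement B G y g) : g ∈ G := by
  induction B generalizing G y g with
  | nil => exact hg ▸ G.one_mem
  | cons b B ih =>
    obtain ⟨j, -, -, g₁, hg₁, -, h, hh, rfl⟩ := hg
    exact G.mul_mem (ih hh).1 hg₁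

theorem IsAscendingElement.permute_mem_openCone {B : List (Fin n)}
    {G : Subgroup (Equiv.Perm (Fin n))} {y : Fin n → ℝ} (hy : Function.Injective y)
    {g : Equiv.Perm (Fin n)} (hg : IsAscendingElement B G y g) :
    permute g y ∈ openCone B G := by
  induction B generalizing G y g with
  | nil => trivial
  | cons b B ih =>
    have hmem := hg.mem
    obtain ⟨j, -, hmin, g₁, -, hj, h, hh, rfl⟩ := hg
    -- The later moves fix `b`, so the minimum placed there stays.
    have hb : (h * g₁)⁻¹ b = j := by
      have hhb : h b = b := hh.mem.2
      rw [Equiv.Perm.inv_eq_iff_eq, Equiv.Perm.mul_apply, hj, hhb]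
    refine ⟨fun j' hj' hne => ?_, ?_⟩
    · refine lt_of_le_of_ne ?_ fun heq => hne (permute_injective hy heq).symm
      simp only [permute, hb]
      exact hmin _ (apply_mem_orbit (G.inv_mem hmem) hj')
    · rw [permute_mul]
      exact ih (permute_injective hy) hh

/-- Both `g · y` and `g' · y` lie in the open cone, and `g' * g⁻¹` carries the first to the second.
-/
theorem IsAscendingElement.unique {B : List (Fin n)} {G : Subgroup (Equiv.Perm (Fin n))}
    (hB : IsBase G B) {y : Fin n → ℝ} (hy : Function.Injective y) {g g' : Equiv.Perm (Fin n)}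
    (hg : IsAscendingElement B G y g) (hg' : IsAscendingElement B G y g') : g = g' := by
  have h : g' * g⁻¹ = 1 := by
    refine eq_one_of_permute_mem_closedCone hB (hg.permute_mem_openCone hy)
      (G.mul_mem hg'.mem (G.inv_mem hg.mem)) ?_
    rw [← permute_mul, inv_mul_cancel_right]
    exact openCone_subset_closedCone B G (hg'.permute_mem_openCone hy)
  exact (mul_inv_eq_one.1 h).symm

theorem perturb_lt_perturb {ε : Fin n → ℝ} (hε : IsPerturbation ε) {x : Fin n → ℝ}
    {i j : Fin n} (hij : x i < x j) : perturb ε x i < perturb ε x j := by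
  -- The index `j` is counted for `x j` but not for `x i`. This gap of at least `1` outweighs the
  -- difference of the perturbations.
  have hcard : (Finset.univ.filter fun k => x k ≤ x i).card + 1 ≤
      (Finset.univ.filter fun k => x k ≤ x j).card := by
    refine Finset.card_lt_card (Finset.ssubset_iff_of_subset ?_ |>.2 ⟨j, by simp, by simpa using hij⟩)
    intro k hk
    simp only [Finset.mem_filter, Finset.mem_univ, true_and] at hk ⊢
    exact hk.trans hij.le
  have hcard' : ((Finset.univ.filter fun k => x k ≤ x i).card : ℝ) + 1 ≤
      (Finset.univ.filter fun k => x k ≤ x j).card := by exact_mod_cast hcard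
  have := (abs_lt.1 (hε.abs_sub_lt_one i j)).2
  simp only [perturb]
  linarith

theorem perturb_injective {ε : Fin n → ℝ} (hε : IsPerturbation ε) (x : Fin n → ℝ) :
    Function.Injective (perturb ε x) := by
  intro i j hij
  rcases lt_trichotomy (x i) (x j) with h | h | h
  · exact absurd hij (perturb_lt_perturb hε h).ne
  · simp only [perturb, h, add_right_inj] at hij
    exact hε.injective hij
  · exact absurd hij (perturb_lt_perturb hε h).ne'

theorem IsAscendingElement.permute_mem_closedCone {B : List (Fin n)}
    {G : Subgroup (Equiv.Perm (Fin n))} {ε : Fin n → ℝ} (hε : IsPerturbation ε)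
    {x : Fin n → ℝ} {g : Equiv.Perm (Fin n)} (hg : IsAscendingElement B G (perturb ε x) g) :
    permute g x ∈ closedCone B G :=
  mem_closedCone_of_mem_openCone (z := permute g (perturb ε x))
    (fun _ _ h => not_lt.1 fun h' => (perturb_lt_perturb hε (x := x) h').not_gt h)
    (hg.permute_mem_openCone (perturb_injective hε x))

/-- The algorithm moves any point with distinct entries into the open cone. -/
theorem openCone_nonempty (B : List (Fin n)) (G : Subgroup (Equiv.Perm (Fin n))) :
    (openCone B G).Nonempty := by
  have hinj : Function.Injective fun i : Fin n => ((i : ℕ) : ℝ) :=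
    Nat.cast_injective.comp Fin.val_injective
  obtain ⟨g, hg⟩ := exists_isAscendingElement B G fun i : Fin n => ((i : ℕ) : ℝ)
  exact ⟨_, hg.permute_mem_openCone hinj⟩

theorem IsAscendingMap.apply_permute {B : List (Fin n)} {G : Subgroup (Equiv.Perm (Fin n))}
    (hB : IsBase G B) {ε : Fin n → ℝ} (hε : IsPerturbation ε)
    {π : (Fin n → ℝ) → (Fin n → ℝ)} (hπ : IsAscendingMap G B ε π) {x : Fin n → ℝ}
    (hx : x ∈ openCone B G) {g : Equiv.Perm (Fin n)} (hg : g ∈ G) : π (permute g x) = x := by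
  obtain ⟨h, hh, hπx⟩ := hπ (permute g x)
  have hmem := hh.permute_mem_closedCone hε
  rw [← permute_mul] at hπx hmem
  rw [hπx, eq_one_of_permute_mem_closedCone hB hx (G.mul_mem hh.mem hg) hmem, permute_one]

theorem IsAscendingMap.interior_range {B : List (Fin n)} {G : Subgroup (Equiv.Perm (Fin n))}
    (hB : IsBase G B) {ε : Fin n → ℝ} (hε : IsPerturbation ε)
    {π : (Fin n → ℝ) → (Fin n → ℝ)} (hπ : IsAscendingMap G B ε π) :
    interior (Set.range π) = openCone B G := by
  refine subset_antisymm ?_ (interior_maximal ?_ (isOpen_openCone B G))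
  · rw [← interior_closedCone (openCone_nonempty B G)]
    refine interior_mono ?_
    rintro _ ⟨x, rfl⟩
    obtain ⟨g, hg, hπx⟩ := hπ x
    exact hπx ▸ hg.permute_mem_closedCone hε
  -- Points of the open cone are fixed by `π`, hence in its image.
  · exact fun x hx => ⟨_, hπ.apply_permute hB hε hx G.one_mem⟩

theorem isFundDomain_openCone {B : List (Fin n)} {G : Subgroup (Equiv.Perm (Fin n))}
    (hB : IsBase G B) {ε : Fin n → ℝ} (hε : IsPerturbation ε) :
    IsFundDomain G (openCone B G) where
  isOpen := isOpen_openCone B G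
  isConnected := ⟨openCone_nonempty B G, (convex_openCone B G).isPreconnected⟩
  orbit_meets_closure x := by
    obtain ⟨g, hg⟩ := exists_isAscendingElement B G (perturb ε x)
    rw [closure_openCone (openCone_nonempty B G)]
    exact ⟨g, hg.mem, hg.permute_mem_closedCone hε⟩
  orbit_meets_once g hg x hx hgx := by
    rw [eq_one_of_permute_mem_closedCone hB hx hg (openCone_subset_closedCone B G hgx),
      permute_one]

theorem IsAscendingMap.isProjectionOnto {B : List (Fin n)}
    {G : Subgroup (Equiv.Perm (Fin n))} (hB : IsBase G B) {ε : Fin n → ℝ}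
    (hε : IsPerturbation ε) {π : (Fin n → ℝ) → (Fin n → ℝ)} (hπ : IsAscendingMap G B ε π) :
    IsProjectionOnto G (openCone B G) π where
  mem_orbit x := by
    obtain ⟨g, hg, hπx⟩ := hπ x
    exact ⟨g, hg.mem, hπx⟩
  mem_closure x := by
    obtain ⟨g, hg, hπx⟩ := hπ x
    rw [closure_openCone (openCone_nonempty B G), hπx]
    exact hg.permute_mem_closedCone hε
  orbit_to_point _ hx _ hg := hπ.apply_permute hB hε hx hg

end CombProj

theorem mainTheorem1 {n : ℕ} (G : Subgroup (Equiv.Perm (Fin n))) (B : List (Fin n))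
    (hB : CombProj.IsBase G B) (ε : Fin n → ℝ) (hε : CombProj.IsPerturbation ε) :
    (∀ x : Fin n → ℝ, ∃! g : Equiv.Perm (Fin n),
        CombProj.IsAscendingElement B G (CombProj.perturb ε x) g) ∧
    (∃! π : (Fin n → ℝ) → (Fin n → ℝ), CombProj.IsAscendingMap G B ε π) ∧
    (∀ π : (Fin n → ℝ) → (Fin n → ℝ), CombProj.IsAscendingMap G B ε π →
        CombProj.IsFundDomain G (interior (Set.range π)) ∧
        CombProj.IsProjectionOnto G (interior (Set.range π)) π) := by
  refine ⟨fun x => ?_, ?_, fun π hπ => ?_⟩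
  · obtain ⟨g, hg⟩ := CombProj.exists_isAscendingElement B G (CombProj.perturb ε x)
    exact ⟨g, hg, fun g' hg' => hg'.unique hB (CombProj.perturb_injective hε x) hg⟩
  · choose φ hφ using fun x => CombProj.exists_isAscendingElement B G (CombProj.perturb ε x)
    refine ⟨fun x => CombProj.permute (φ x) x, fun x => ⟨φ x, hφ x, rfl⟩, fun π hπ => ?_⟩
    funext x
    obtain ⟨g, hg, hπx⟩ := hπ x
    rw [hπx, hg.unique hB (CombProj.perturb_injective hε x) (hφ x)]
  · rw [hπ.interior_range hB hε]
    exact ⟨CombProj.isFundDomain_openCone hB hε, hπ.isProjectionOnto hB hε⟩
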